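/- Let $\Omega\subset\mathbb{R}^3$ be either a bounded open set with zero Dirichlet (no-slip) boundary conditions or a periodic box. Let $V$ be the closure in $H^1(\Omega)^3$ of the smooth vector fields with compact support in $\Omega$ (so $V=H^1_0(\Omega)^3$), respectively of the smooth periodic vector fields of zero mean, and let $V'\supset L^2(\Omega)^3$ be its dual. Let $A=-\Delta$ with these boundary conditions. It is positive definite with discrete spectrum; let $P_\lambda$ denote the projection to the eigenspace of $A$ for the eigenvalue $\lambda$, which extends to $V'$ by duality. For real $r$ put $A^rF=\sum_\lambda\lambda^rP_\lambda F$, defined for those $F\in V'$ for which the series converges in $L^2(\Omega)^3$; these $F$ form the domain $D(A^r)$. **Theorem 1.** Let $u$ be a solution on $\Omega\times(0,T)$ of the Navier–Stokes equations $$u_t+\nu Au+(u\cdot\nabla)u+\nabla p=g,\qquad \nabla\cdot u=0,$$ with $\nu>0$ and $g(t)\in L^2(\Omega)^3$, or of the Euler equations $$u_t+(u\cdot\nabla)u+\nabla p=0,\qquad \nabla\cdot u=0,$$ where $u(t)\in V$ for every $t$ (in particular $u$ satisfies the boundary conditions) and where at every $t\in(0,T)$ the momentum equation holds in the sense of distributions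 in the space variable: for every test field $\varphi$ (one of the smooth fields used to define $V$), $p(t)\,\nabla\cdot\varphi$ is integrable, and $t\mapsto\int_\Omega u(t)\cdot\varphi$ is differentiable with the derivative that the equation prescribes. Let $\omega=\nabla\times u$. Then for every $t\in(0,T)$ and every real $s$ with $u(t)\in D(A^s)$, the distribution $\nabla\times\omega(t)\in V'$ lies in $D(A^{s-1})$ and $$A^su(t)=A^{s-1}(\nabla\times\omega(t)).$$ -/

import Mathlib

open MeasureTheory
open scoped ContDiff InnerProductSpace

noncomputable section

namespace Fluid

/-- Euclidean three-space. -/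
abbrev R3 : Type := EuclideanSpace ℝ (Fin 3)

/-- The two kinds of spatial domain: a bounded open set with no-slip (zero Dirichlet) boundary
conditions, or a periodic box with side lengths `L 0, L 1, L 2`. -/
inductive SpatialDomain : Type
  | noSlip (Ω : Set R3) (isOpen : IsOpen Ω) (isBounded : Bornology.IsBounded Ω) : SpatialDomain
  | periodicBox (L : Fin 3 → ℝ) (pos : ∀ i, 0 < L i) : SpatialDomain

/-- The underlying open set `Ω` (for a periodic box: one open period cell). -/
def SpatialDomain.carrier : SpatialDomain → Set R3
  | .noSlip Ω _ _ => Ω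
  | .periodicBox L _ => {x | ∀ i, 0 < x i ∧ x i < L i}

/-- Lebesgue measure on `Ω`. -/
def SpatialDomain.measure (D : SpatialDomain) : Measure R3 := volume.restrict D.carrier

/-- Smooth test vector fields. No-slip: smooth fields with compact support in `Ω`.
Periodic box: smooth periodic fields with zero mean (the constant vectors are modded out). -/
def IsTest : SpatialDomain → (R3 → R3) → Prop
  | .noSlip Ω _ _, φ => ContDiff ℝ ∞ φ ∧ HasCompactSupport φ ∧ tsupport φ ⊆ Ω
  | .periodicBox L hL, φ => ContDiff ℝ ∞ φ ∧
      (∀ (i : Fin 3) (x : R3), φ (x + EuclideanSpace.single i (L i)) = φ x) ∧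
      ∀ i : Fin 3, ∫ x, φ x i ∂(SpatialDomain.periodicBox L hL).measure = 0

/-- The classical partial derivative `∂_j φ_i` at `x`. -/
def partialD (φ : R3 → R3) (j i : Fin 3) (x : R3) : ℝ :=
  fderiv ℝ φ x (EuclideanSpace.single j 1) i

/-- Square integrable vector fields `L²(Ω)³`, with inner product `∑ i, ∫ u_i v_i`. -/
abbrev L2 (D : SpatialDomain) : Type := PiLp 2 (fun _ : Fin 3 => Lp ℝ 2 D.measure)

/-- Pairs `(u, (∂_0 u, ∂_1 u, ∂_2 u))` of a field and its first partial derivatives; the inner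
product is that of `H¹`. -/
abbrev Jet (D : SpatialDomain) : Type :=
  WithLp 2 (L2 D × PiLp 2 (fun _ : Fin 3 => L2 D))

/-- The jets `(φ, ∇φ)` of the test fields. -/
def testJets (D : SpatialDomain) : Set (Jet D) :=
  {z | ∃ φ : R3 → R3, IsTest D φ ∧
    (∀ i, (z.fst i : R3 → ℝ) =ᵐ[D.measure] fun x => φ x i) ∧
    ∀ j i, (z.snd j i : R3 → ℝ) =ᵐ[D.measure] partialD φ j i}

/-- The closure of the test fields in `H¹`. -/
def VSub (D : SpatialDomain) : Submodule ℝ (Jet D) :=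
  (Submodule.span ℝ (testJets D)).topologicalClosure

/-- The Sobolev space `V` of vector fields subject to the boundary conditions: the closure in `H¹`
of the test fields. This is `H¹₀(Ω)³` in the no-slip case, and the space of periodic `H¹` fields
with zero mean for a periodic box. An element is stored with its (weak) derivatives. -/
def V (D : SpatialDomain) : Type := VSub D

instance (D : SpatialDomain) : NormedAddCommGroup (V D) := inferInstanceAs (NormedAddCommGroup (VSub D))

instance (D : SpatialDomain) : InnerProductSpace ℝ (V D) :=
  inferInstanceAs (InnerProductSpace ℝ (VSub D))

instance (D : SpatialDomain) : CompleteSpace (V D) :=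
  inferInstanceAs (CompleteSpace (Submodule.span ℝ (testJets D)).topologicalClosure)

/-- The isometric inclusion of `V` into `H¹`. -/
def jet (D : SpatialDomain) : V D →L[ℝ] Jet D := (VSub D).subtypeL

/-- The inclusion `V → L²`. -/
def val (D : SpatialDomain) : V D →L[ℝ] L2 D :=
  (WithLp.fstL 2 ℝ (L2 D) (PiLp 2 (fun _ : Fin 3 => L2 D))) ∘L jet D

/-- The vector `∂_j u` of partial derivatives of `u ∈ V`. -/
def derivVec (D : SpatialDomain) (j : Fin 3) : V D →L[ℝ] L2 D :=
  (PiLp.proj 2 (fun _ : Fin 3 => L2 D) j) ∘L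
    (WithLp.sndL 2 ℝ (L2 D) (PiLp 2 (fun _ : Fin 3 => L2 D))) ∘L jet D

/-- The partial derivative `∂_j u_i` of `u ∈ V`. -/
def deriv (D : SpatialDomain) (j i : Fin 3) : V D →L[ℝ] Lp ℝ 2 D.measure :=
  (PiLp.proj 2 (fun _ : Fin 3 => Lp ℝ 2 D.measure) i) ∘L derivVec D j

/-- The divergence `∇ • u` of `u ∈ V`. -/
def div (D : SpatialDomain) : V D →L[ℝ] Lp ℝ 2 D.measure := ∑ i, deriv D i i

/-- The curl `∇ × u` of `u ∈ V`, an `L²` vector field. -/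
def curl (D : SpatialDomain) : V D →L[ℝ] L2 D :=
  ((PiLp.continuousLinearEquiv 2 ℝ (fun _ : Fin 3 => Lp ℝ 2 D.measure)).symm :
      (Fin 3 → Lp ℝ 2 D.measure) →L[ℝ] L2 D) ∘L
    ContinuousLinearMap.pi
      ![deriv D 1 2 - deriv D 2 1, deriv D 2 0 - deriv D 0 2, deriv D 0 1 - deriv D 1 0]

/-- The dual `V'` of `V` (the space `H⁻¹` for the given boundary conditions). As the test fields
are dense in `V`, its elements are distributions. -/
abbrev VDual (D : SpatialDomain) : Type := StrongDual ℝ (V D)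

/-- The embedding `L² → V'`, a field `f` acting by `φ ↦ ∫ f • φ`. -/
def ofL2 (D : SpatialDomain) (f : L2 D) : VDual D := innerSL ℝ f ∘L val D

/-- The distributional curl `∇ × w ∈ V'` of an `L²` field `w`: it acts by
`φ ↦ ∫ w • (∇ × φ)`. -/
def weakCurl (D : SpatialDomain) (w : L2 D) : VDual D := innerSL ℝ w ∘L curl D

/-- The quadratic form `∫ ∇u : ∇v` of the operator `A = -Δ`. -/
def energy (D : SpatialDomain) (u v : V D) : ℝ := ∑ j, ⟪derivVec D j u, derivVec D j v⟫_ℝ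

/-- The eigenspace of `A = -Δ` for `lam`: the `e ∈ V` with `-Δ e = lam e` in `V'`. -/
def eigenspace (D : SpatialDomain) (lam : ℝ) : Submodule ℝ (V D) where
  carrier := {e | ∀ v, energy D e v = lam * ⟪val D e, val D v⟫_ℝ}
  add_mem' := by
    intro a b ha hb v
    have h1 := ha v
    have h2 := hb v
    simp only [energy] at h1 h2
    simp only [energy, map_add, inner_add_left, Finset.sum_add_distrib]
    rw [h1, h2]; ring
  zero_mem' := by intro v; simp [energy]
  smul_mem' := by
    intro c a ha v
    have h1 := ha v
    simp only [energy] at h1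
    simp only [energy, map_smul, real_inner_smul_left, ← Finset.mul_sum]
    rw [h1]; ring

theorem isClosed_eigenspace (D : SpatialDomain) (lam : ℝ) :
    IsClosed (eigenspace D lam : Set (V D)) := by
  have : (eigenspace D lam : Set (V D)) =
      ⋂ v, {e | energy D e v = lam * ⟪val D e, val D v⟫_ℝ} := by
    ext e; simp [eigenspace]
  rw [this]
  refine isClosed_iInter fun v => isClosed_eq ?_ ?_
  · unfold energy; fun_prop
  · fun_prop

instance (D : SpatialDomain) (lam : ℝ) : CompleteSpace (eigenspace D lam) :=
  (isClosed_eigenspace D lam).completeSpace_coe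

/-- The spectral component `P_lam F` of `F ∈ V'`: the element of the eigenspace with
`∫ (P_lam F) • e = F e` for every `e` in the eigenspace (see `inner_component`). For `F ∈ L²` this
is the `L²`-orthogonal projection of `F` to the eigenspace. The factor `1 + lam` is the ratio of
the `H¹` and `L²` inner products on the eigenspace. -/
def component (D : SpatialDomain) (lam : ℝ) : VDual D →ₗ[ℝ] V D where
  toFun F := (1 + lam) • (eigenspace D lam).starProjection ((InnerProductSpace.toDual ℝ (V D)).symm F)
  map_add' := by intro a b; rw [map_add, map_add, smul_add]
  map_smul' := by intro c a; simp only [map_smulₛₗ, RingHom.id_apply]; exact smul_comm _ _ _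

theorem component_mem (D : SpatialDomain) (lam : ℝ) (F : VDual D) :
    component D lam F ∈ eigenspace D lam :=
  Submodule.smul_mem _ _ (Submodule.starProjection_apply_mem _ _)

theorem inner_component (D : SpatialDomain) (lam : ℝ) (F : VDual D) (e : V D)
    (he : e ∈ eigenspace D lam) : ⟪val D (component D lam F), val D e⟫_ℝ = F e := by
  set q := (eigenspace D lam).starProjection ((InnerProductSpace.toDual ℝ (V D)).symm F) with hq
  have hqm : q ∈ eigenspace D lam := Submodule.starProjection_apply_mem _ _
  have h1 : ⟪q, e⟫_ℝ = F e := by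
    rw [hq, Submodule.inner_starProjection_left_eq_right,
      Submodule.starProjection_eq_self_iff.mpr he, InnerProductSpace.toDual_symm_apply]
  have h2 : ⟪q, e⟫_ℝ = ⟪val D q, val D e⟫_ℝ + energy D q e := by
    change ⟪jet D q, jet D e⟫_ℝ = _
    rw [WithLp.prod_inner_apply]
    congr 1
  have h3 : energy D q e = lam * ⟪val D q, val D e⟫_ℝ := hqm e
  have h4 : component D lam F = (1 + lam) • q := rfl
  rw [h4, map_smul, real_inner_smul_left, ← h1, h2, h3]; ring

/-- The power `A^r`, `r ∈ ℝ`, of `A = -Δ` (which has discrete spectrum) by its spectral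
decomposition: `A^r F = ∑ lam^r P_lam F`, the sum over the eigenvalues of `A` (for other `lam` the
component vanishes). It is defined on those `F ∈ V'`, in particular those `F ∈ L²`, for which the
orthogonal series converges in `L²`, that is, `∑ lam^(2r) ‖P_lam F‖² < ∞`. -/
def powA (D : SpatialDomain) (r : ℝ) : VDual D →ₗ.[ℝ] L2 D where
  domain :=
    { carrier := {F | Summable fun lam : ℝ => lam ^ r • val D (component D lam F)}
      add_mem' := by
        intro a b ha hb
        simpa only [Set.mem_ofPred_eq, map_add, smul_add] using Summable.add ha hb
      zero_mem' := by simp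
      smul_mem' := by
        intro c a ha
        simpa only [Set.mem_ofPred_eq, map_smul, smul_comm _ c] using Summable.const_smul c ha }
  toFun :=
    { toFun := fun F => ∑' lam : ℝ, lam ^ r • val D (component D lam F)
      map_add' := by
        intro a b
        simp only [Submodule.coe_add, map_add, smul_add]
        exact Summable.tsum_add a.2 b.2
      map_smul' := by
        intro c a
        simp only [Submodule.coe_smul, map_smul, smul_comm _ c, RingHom.id_apply]
        exact Summable.tsum_const_smul c a.2 }

/-- `u` (with pressure `p`) solves on `Ω × (0, T)` the system
`u_t + ν A u + (u • ∇) u + ∇p = g`, `∇ • u = 0`, with `u(t) ∈ V` expressing the boundary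
conditions. The momentum equation is required at every time, in the sense of distributions in the
space variable. -/
structure IsSolution (D : SpatialDomain) (T ν : ℝ) (g : ℝ → L2 D) (u : ℝ → V D)
    (p : ℝ → R3 → ℝ) : Prop where
  div_eq_zero : ∀ t ∈ Set.Ioo 0 T, div D (u t) = 0
  pressure_integrable : ∀ t ∈ Set.Ioo 0 T, ∀ φ, IsTest D φ →
    Integrable (fun x => p t x * ∑ i, partialD φ i i x) D.measure
  momentum : ∀ t ∈ Set.Ioo 0 T, ∀ φ, IsTest D φ →
    HasDerivAt (fun τ => ∑ i, ∫ x, val D (u τ) i x * φ x i ∂D.measure)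
      (- ν * (∑ j, ∑ i, ∫ x, deriv D j i (u t) x * partialD φ j i x ∂D.measure)
        - (∑ i, ∑ j, ∫ x, val D (u t) j x * deriv D j i (u t) x * φ x i ∂D.measure)
        + (∫ x, p t x * ∑ i, partialD φ i i x ∂D.measure)
        + ∑ i, ∫ x, g t i x * φ x i ∂D.measure) t

/-- Solutions of the Navier–Stokes equations: viscosity `ν > 0`, external force `g`. -/
def IsNavierStokesSolution (D : SpatialDomain) (T : ℝ) (u : ℝ → V D) (p : ℝ → R3 → ℝ) : Prop :=
  ∃ ν : ℝ, 0 < ν ∧ ∃ g : ℝ → L2 D, IsSolution D T ν g u p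

/-- Solutions of the Euler equations: zero viscosity, no force. -/
def IsEulerSolution (D : SpatialDomain) (T : ℝ) (u : ℝ → V D) (p : ℝ → R3 → ℝ) : Prop :=
  IsSolution D T 0 (fun _ => 0) u p

end Fluid

end

noncomputable section

namespace Fluid

/-! Incompressibility gives `∇ × ω = -Δu`, and the point is that this holds in `V'`, tested against
all of `V`, with no boundary condition on `ω`. For `v, w ∈ V`, `∫ ∂_i v_j ∂_j w_i = ∫ ∂_j v_j ∂_i
w_i`: for a test field `w` all derivatives can be moved onto `w`, where they commute, and test
fields are dense (`inner_deriv_comm`). So the curl form is the Dirichlet form minus the divergence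
form (`inner_curl_curl`).

Pairing with eigenvectors gives `P_lam (∇ × ω) = lam P_lam u`, so the series for `A^(s-1) (∇ × ω)`
and `A^s u` agree term by term, as soon as the terms with `lam ≤ 0` vanish. That is positive
definiteness, which reduces to showing that a field in `V` with zero gradient is zero
(`val_eq_zero_of_deriv_eq_zero`). It is obtained from translation invariance rather than from a
Poincaré inequality. -/

/-- The coordinate unit vector. -/
abbrev unitVec (j : Fin 3) : R3 := EuclideanSpace.single j 1

/-! ### Boundedness and finite measure of the domain. -/

theorem SpatialDomain.isOpen_carrier (D : SpatialDomain) : IsOpen D.carrier := by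
  cases D with
  | noSlip Ω h _ => exact h
  | periodicBox L _ =>
    have : (SpatialDomain.periodicBox L ‹_›).carrier =
        ⋂ i, {x : R3 | 0 < x i} ∩ {x : R3 | x i < L i} := by
      ext x; simp [SpatialDomain.carrier]
    rw [this]
    refine isOpen_iInter_of_finite fun i => (isOpen_lt ?_ ?_).inter (isOpen_lt ?_ ?_) <;> fun_prop

theorem SpatialDomain.measurableSet_carrier (D : SpatialDomain) : MeasurableSet D.carrier :=
  D.isOpen_carrier.measurableSet

theorem SpatialDomain.exists_norm_le (D : SpatialDomain) :
    ∃ R, 0 < R ∧ ∀ x ∈ D.carrier, ‖x‖ ≤ R := by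
  cases D with
  | noSlip Ω _ h =>
    obtain ⟨R, hR⟩ := isBounded_iff_forall_norm_le.1 h
    exact ⟨max R 1, by positivity, fun x hx => (hR x hx).trans (le_max_left _ _)⟩
  | periodicBox L hL =>
    refine ⟨√(∑ i, L i ^ 2), Real.sqrt_pos.2
      (Finset.sum_pos (fun i _ => pow_pos (hL i) 2) Finset.univ_nonempty), fun x hx => ?_⟩
    rw [EuclideanSpace.norm_eq]
    refine Real.sqrt_le_sqrt (Finset.sum_le_sum fun i _ => ?_)
    have h := hx i
    rw [Real.norm_of_nonneg h.1.le]
    exact pow_le_pow_left₀ h.1.le h.2.le 2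

instance (D : SpatialDomain) : IsFiniteMeasure D.measure := by
  obtain ⟨R, _, hR⟩ := D.exists_norm_le
  refine ⟨?_⟩
  rw [SpatialDomain.measure, Measure.restrict_apply_univ]
  exact (isBounded_iff_forall_norm_le.2 ⟨R, hR⟩).measure_lt_top

theorem ae_mem_carrier (D : SpatialDomain) : ∀ᵐ x ∂D.measure, x ∈ D.carrier :=
  ae_restrict_mem D.measurableSet_carrier

/-! ### Multipliers: a class of scalar functions closed under derivatives, translations and
products. -/

/-- A smooth scalar function that is compatible with the periodicity of the domain; no boundary
values are prescribed in the no-slip case. -/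
def IsMultiplier : SpatialDomain → (R3 → ℝ) → Prop
  | .noSlip _ _ _, ψ => ContDiff ℝ ∞ ψ
  | .periodicBox L _, ψ => ContDiff ℝ ∞ ψ ∧
      ∀ (i : Fin 3) (x : R3), ψ (x + EuclideanSpace.single i (L i)) = ψ x

namespace IsMultiplier

variable {D : SpatialDomain} {ψ : R3 → ℝ}

theorem contDiff (h : IsMultiplier D ψ) : ContDiff ℝ ∞ ψ := by
  cases D with
  | noSlip => exact h
  | periodicBox => exact h.1

theorem continuous (h : IsMultiplier D ψ) : Continuous ψ := h.contDiff.continuous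

theorem differentiable (h : IsMultiplier D ψ) : Differentiable ℝ ψ :=
  h.contDiff.differentiable (by simp)

theorem translate (h : IsMultiplier D ψ) (a : R3) : IsMultiplier D fun x => ψ (x + a) := by
  have h1 : ContDiff ℝ ∞ fun x => ψ (x + a) := 
    h.contDiff.comp (contDiff_id.add contDiff_const : ContDiff ℝ ∞ fun x : R3 => x + a)
  cases D with
  | noSlip => exact h1
  | periodicBox L _ => exact ⟨h1, fun i x => by
      change ψ (x + _ + a) = _
      rw [add_right_comm]; exact h.2 i _⟩

theorem fderiv_apply (h : IsMultiplier D ψ) (a : R3) : IsMultiplier D fun x => fderiv ℝ ψ x a := by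
  have h1 : ContDiff ℝ ∞ fun x => fderiv ℝ ψ x a :=
    (h.contDiff.fderiv_right (by simp)).clm_apply contDiff_const
  cases D with
  | noSlip => exact h1
  | periodicBox L _ =>
    refine ⟨h1, fun i x => ?_⟩
    have h2 : (fun y => ψ (y + EuclideanSpace.single i (L i))) = ψ := funext (h.2 i)
    change fderiv ℝ ψ _ a = fderiv ℝ ψ x a
    rw [← fderiv_comp_add_right, h2]

theorem memLp (h : IsMultiplier D ψ) (q : ENNReal) : MemLp ψ q D.measure := by
  obtain ⟨R, _, hR⟩ := D.exists_norm_le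
  obtain ⟨C, hC⟩ := (isCompact_closedBall (0 : R3) R).exists_bound_of_continuousOn
    h.continuous.continuousOn
  refine MemLp.of_bound h.continuous.aestronglyMeasurable C ?_
  filter_upwards [ae_mem_carrier D] with x hx
  exact hC x (mem_closedBall_zero_iff.2 (hR x hx))

theorem integrable (h : IsMultiplier D ψ) : Integrable ψ D.measure :=
  memLp_one_iff_integrable.1 (h.memLp 1)

theorem mul {χ : R3 → ℝ} (h : IsMultiplier D ψ) (h' : IsMultiplier D χ) :
    IsMultiplier D fun x => ψ x * χ x := by
  have h1 := h.contDiff.mul h'.contDiff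
  cases D with
  | noSlip => exact h1
  | periodicBox L _ => exact ⟨h1, fun i x => by simp only [h.2 i x, h'.2 i x]⟩

end IsMultiplier

namespace IsTest

variable {D : SpatialDomain} {φ : R3 → R3}

theorem contDiff (h : IsTest D φ) : ContDiff ℝ ∞ φ := by
  cases D with
  | noSlip => exact h.1
  | periodicBox => exact h.1

theorem isMultiplier (h : IsTest D φ) (i : Fin 3) : IsMultiplier D fun x => φ x i := by
  have h1 : ContDiff ℝ ∞ fun x => φ x i :=
    (EuclideanSpace.proj (𝕜 := ℝ) i).contDiff.comp h.contDiff
  cases D with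
  | noSlip => exact h1
  | periodicBox L _ => exact ⟨h1, fun j x => by simp only [h.2.1 j x]⟩

theorem partialD_eq (h : IsTest D φ) (j i : Fin 3) (x : R3) :
    partialD φ j i x = fderiv ℝ (fun y => φ y i) x (unitVec j) := by
  have h1 : HasFDerivAt φ (fderiv ℝ φ x) x :=
    (h.contDiff.differentiable (by simp) x).hasFDerivAt
  have h2 : HasFDerivAt (fun y => φ y i) ((EuclideanSpace.proj (𝕜 := ℝ) i) ∘L fderiv ℝ φ x) x :=
    (EuclideanSpace.proj (𝕜 := ℝ) i).hasFDerivAt.comp x h1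
  rw [h2.fderiv]; rfl

end IsTest

/-! ### Integration by parts for smooth fields. -/

theorem setIntegral_box (L : Fin 3 → ℝ) (hL : ∀ i, 0 < L i) (f : R3 → ℝ) :
    ∫ x, f x ∂(SpatialDomain.periodicBox L hL).measure =
      ∫ y in Set.Icc 0 L, f (WithLp.toLp 2 y) := by
  have h1 : (WithLp.toLp 2 : (Fin 3 → ℝ) → R3) ⁻¹' (SpatialDomain.periodicBox L hL).carrier =
      Set.pi Set.univ fun i => Set.Ioo (0 : ℝ) (L i) := by
    ext y; simp [SpatialDomain.carrier]
  rw [SpatialDomain.measure, ← (PiLp.volume_preserving_toLp (Fin 3)).setIntegral_preimage_emb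
    (MeasurableEquiv.toLp 2 (Fin 3 → ℝ)).measurableEmbedding, h1]
  exact setIntegral_congr_set Measure.univ_pi_Ioo_ae_eq_Icc

/-- The divergence theorem for the field `f e_j`: only the two faces normal to `e_j` contribute, and
they cancel by periodicity. -/
theorem integral_fderiv_periodic (L : Fin 3 → ℝ) (hL : ∀ i, 0 < L i) {f : R3 → ℝ}
    (hf : IsMultiplier (.periodicBox L hL) f) (j : Fin 3) :
    ∫ x, fderiv ℝ f x (unitVec j) ∂(SpatialDomain.periodicBox L hL).measure = 0 := by
  rw [setIntegral_box]
  let e : (Fin 3 → ℝ) ≃L[ℝ] R3 := (PiLp.continuousLinearEquiv 2 ℝ (fun _ : Fin 3 => ℝ)).symm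
  let F : Fin 3 → (Fin 3 → ℝ) → ℝ := fun i y => if i = j then f (e y) else 0
  let F' : Fin 3 → (Fin 3 → ℝ) → (Fin 3 → ℝ) →L[ℝ] ℝ := fun i y =>
    if i = j then fderiv ℝ f (e y) ∘L (e : (Fin 3 → ℝ) →L[ℝ] R3) else 0
  have hsum : ∀ y, ∑ i, F' i y (Pi.single i 1) = fderiv ℝ f (WithLp.toLp 2 y) (unitVec j) := by
    intro y
    rw [Finset.sum_eq_single j (fun i _ hi => by simp [F', hi]) (by simp)]
    simp only [F', if_true, ContinuousLinearMap.comp_apply]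
    rfl
  have hcont : Continuous fun y => fderiv ℝ f (e y) (unitVec j) :=
    (hf.fderiv_apply _).continuous.comp e.continuous
  have key := integral_divergence_of_hasFDerivAt_off_countable' (0 : Fin 3 → ℝ) L
    (fun i => (hL i).le) F F' ∅ Set.countable_empty
    (fun i => by
      by_cases hi : i = j
      · simp only [F, hi, if_true]
        exact (hf.continuous.comp e.continuous).continuousOn
      · simp only [F, hi, if_false]; exact continuousOn_const)
    (fun y _ i => by
      by_cases hi : i = j
      · simp only [F, F', hi, if_true]
        exact (hf.differentiable (e y)).hasFDerivAt.comp y e.hasFDerivAt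
      · simp only [F, F', hi, if_false]; exact hasFDerivAt_const _ _)
    (by
      simp only [hsum]
      exact hcont.continuousOn.integrableOn_compact isCompact_Icc)
  simp only [hsum] at key
  rw [key]
  refine Finset.sum_eq_zero fun i _ => ?_
  by_cases hi : i = j
  · subst hi
    rw [sub_eq_zero]
    congr 1
    ext y
    simp only [F, if_true]
    -- Shifting the face `x_i = 0` by one period gives the face `x_i = L i`.
    rw [← hf.2 i (e (i.insertNth ((0 : Fin 3 → ℝ) i) y))]
    congr 1
    ext k
    refine Fin.succAboveCases i ?_ (fun m => ?_) k
    · simp [e]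
    · simp [e]
  · simp [F, hi]

/-- Integration by parts against a test field. -/
theorem IsTest.integral_mul_fderiv {D : SpatialDomain} {φ : R3 → R3} {ψ : R3 → ℝ}
    (hφ : IsTest D φ) (hψ : IsMultiplier D ψ) (j i : Fin 3) :
    ∫ x, ψ x * partialD φ j i x ∂D.measure +
      ∫ x, fderiv ℝ ψ x (unitVec j) * φ x i ∂D.measure = 0 := by
  simp only [hφ.partialD_eq]
  have hm := hφ.isMultiplier i
  have hm' := hm.fderiv_apply (unitVec j)
  have hψ' := hψ.fderiv_apply (unitVec j)
  cases D with
  | noSlip Ω ho hb =>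
    have hc : HasCompactSupport fun x => φ x i :=
      hφ.2.1.comp_left (g := fun y : R3 => y i) rfl
    have hs : tsupport (fun x => φ x i) ⊆ Ω :=
      (closure_mono fun x (hx : φ x i ≠ 0) (h : φ x = 0) => hx (by simp [h])).trans hφ.2.2
    have hc' : HasCompactSupport fun x => fderiv ℝ (fun y => φ y i) x (unitVec j) :=
      hc.fderiv_apply ℝ (unitVec j)
    have hs' : Function.support (fun x => fderiv ℝ (fun y => φ y i) x (unitVec j)) ⊆ Ω := by
      refine Set.Subset.trans (fun x hx => ?_) ((support_fderiv_subset ℝ).trans hs)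
      exact fun h => hx (by simp [h])
    -- The factor from `φ` is supported in `Ω`, so both integrals extend to the whole space, where
    -- there is no boundary term.
    have e1 : ∫ x, ψ x * fderiv ℝ (fun y => φ y i) x (unitVec j)
        ∂(SpatialDomain.noSlip Ω ho hb).measure =
        ∫ x, ψ x * fderiv ℝ (fun y => φ y i) x (unitVec j) :=
      setIntegral_eq_integral_of_forall_compl_eq_zero fun x hx => by
        rw [Function.notMem_support.1 fun h => hx (hs' h), mul_zero]
    have e2 : ∫ x, fderiv ℝ ψ x (unitVec j) * φ x i ∂(SpatialDomain.noSlip Ω ho hb).measure =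
        ∫ x, fderiv ℝ ψ x (unitVec j) * φ x i :=
      setIntegral_eq_integral_of_forall_compl_eq_zero fun x hx => by
        rw [show φ x i = 0 from
          image_eq_zero_of_notMem_tsupport (f := fun x => φ x i) fun h => hx (hs h), mul_zero]
    rw [e1, e2, integral_mul_fderiv_eq_neg_fderiv_mul_of_integrable, neg_add_cancel]
    · exact (hψ'.continuous.mul hm.continuous).integrable_of_hasCompactSupport hc.mul_left
    · exact (hψ.continuous.mul hm'.continuous).integrable_of_hasCompactSupport hc'.mul_left
    · exact (hψ.continuous.mul hm.continuous).integrable_of_hasCompactSupport hc.mul_left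
    · exact fun x _ => hψ.differentiable x
    · exact fun x _ => hm.differentiable x
  | periodicBox L hL =>
    rw [← integral_add (hψ.mul hm').integrable (hψ'.mul hm).integrable,
      ← integral_fderiv_periodic L hL (hψ.mul hm) j]
    congr 1
    ext x
    rw [fderiv_fun_mul (hψ.differentiable x) (hm.differentiable x)]
    simp [mul_comm]

theorem IsMultiplier.fderiv_fderiv_comm {D : SpatialDomain} {ψ : R3 → ℝ} (h : IsMultiplier D ψ)
    (a b x : R3) :
    fderiv ℝ (fun y => fderiv ℝ ψ y a) x b = fderiv ℝ (fun y => fderiv ℝ ψ y b) x a := by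
  have hd : DifferentiableAt ℝ (fderiv ℝ ψ) x :=
    (h.contDiff.fderiv_right (m := ∞) (by simp)).differentiable (by simp) x
  have hs : IsSymmSndFDerivAt ℝ ψ x :=
    h.contDiff.contDiffAt.isSymmSndFDerivAt
      (by rw [minSmoothness_of_isRCLikeNormedField]; exact WithTop.coe_le_coe.2 le_top)
  rw [fderiv_clm_apply hd (by fun_prop), fderiv_clm_apply hd (by fun_prop)]
  simpa using hs b a

/-! ### From test fields to `V` by density. -/

/-- The class of a multiplier in `L²`. -/
def IsMultiplier.toL2 {D : SpatialDomain} {ψ : R3 → ℝ} (h : IsMultiplier D ψ) :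
    Lp ℝ 2 D.measure :=
  (h.memLp 2).toLp ψ

theorem IsMultiplier.inner_toL2 {D : SpatialDomain} {ψ : R3 → ℝ} (h : IsMultiplier D ψ)
    (f : Lp ℝ 2 D.measure) : ⟪h.toL2, f⟫_ℝ = ∫ x, ψ x * f x ∂D.measure := by
  rw [L2.inner_def]
  refine integral_congr_ae ?_
  filter_upwards [(h.memLp 2).coeFn_toLp] with x hx
  rw [IsMultiplier.toL2, hx]
  simp [mul_comm]

/-- The components of the field of a jet. -/
def jetVal (D : SpatialDomain) (i : Fin 3) : Jet D →L[ℝ] Lp ℝ 2 D.measure :=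
  (PiLp.proj 2 (fun _ : Fin 3 => Lp ℝ 2 D.measure) i) ∘L
    (WithLp.fstL 2 ℝ (L2 D) (PiLp 2 (fun _ : Fin 3 => L2 D)))

/-- The partial derivatives of the components of the field of a jet. -/
def jetDeriv (D : SpatialDomain) (j i : Fin 3) : Jet D →L[ℝ] Lp ℝ 2 D.measure :=
  (PiLp.proj 2 (fun _ : Fin 3 => Lp ℝ 2 D.measure) i) ∘L
    (PiLp.proj 2 (fun _ : Fin 3 => L2 D) j) ∘L
      (WithLp.sndL 2 ℝ (L2 D) (PiLp 2 (fun _ : Fin 3 => L2 D)))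

theorem jetVal_jet (D : SpatialDomain) (i : Fin 3) (v : V D) :
    jetVal D i (jet D v) = val D v i := rfl

theorem derivVec_apply (D : SpatialDomain) (j i : Fin 3) (v : V D) :
    derivVec D j v i = deriv D j i v := rfl

/-- A continuous functional on jets that vanishes on the test jets vanishes on `V`. -/
theorem eq_zero_of_testJets {D : SpatialDomain} (ℓ : Jet D →L[ℝ] ℝ)
    (h : ∀ z ∈ testJets D, ℓ z = 0) (v : V D) : ℓ (jet D v) = 0 := by
  have h1 : VSub D ≤ ℓ.ker :=
    Submodule.topologicalClosure_minimal _ (Submodule.span_le.2 h) ℓ.isClosed_ker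
  exact h1 v.2

theorem testJets_spec {D : SpatialDomain} {z : Jet D} (hz : z ∈ testJets D) :
    ∃ (φ : R3 → R3) (hφ : IsTest D φ), (∀ i, jetVal D i z = (hφ.isMultiplier i).toL2) ∧
      ∀ j i, jetDeriv D j i z = ((hφ.isMultiplier i).fderiv_apply (unitVec j)).toL2 := by
  obtain ⟨φ, hφ, h1, h2⟩ := hz
  refine ⟨φ, hφ, fun i => Lp.ext ((h1 i).trans (MemLp.coeFn_toLp _).symm), fun j i => Lp.ext ?_⟩
  refine (h2 j i).trans (Filter.EventuallyEq.trans ?_ (MemLp.coeFn_toLp _).symm)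
  exact Filter.Eventually.of_forall fun x => hφ.partialD_eq j i x

/-- Integration by parts of a field in `V` against a multiplier. -/
theorem inner_toL2_deriv {D : SpatialDomain} {ψ : R3 → ℝ} (hψ : IsMultiplier D ψ) (j i : Fin 3)
    (v : V D) :
    ⟪hψ.toL2, deriv D j i v⟫_ℝ = -⟪(hψ.fderiv_apply (unitVec j)).toL2, val D v i⟫_ℝ := by
  rw [eq_neg_iff_add_eq_zero]
  refine eq_zero_of_testJets (innerSL ℝ hψ.toL2 ∘L jetDeriv D j i +
    innerSL ℝ (hψ.fderiv_apply (unitVec j)).toL2 ∘L jetVal D i) (fun z hz => ?_) v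
  obtain ⟨φ, hφ, h1, h2⟩ := hz
  change ⟪hψ.toL2, jetDeriv D j i z⟫_ℝ + ⟪_, jetVal D i z⟫_ℝ = 0
  rw [IsMultiplier.inner_toL2, IsMultiplier.inner_toL2, ← hφ.integral_mul_fderiv hψ j i]
  congr 1
  · refine integral_congr_ae ?_
    filter_upwards [h2 j i] with x hx
    exact congrArg _ hx
  · refine integral_congr_ae ?_
    filter_upwards [h1 i] with x hx
    exact congrArg _ hx

theorem IsMultiplier.toL2_congr {D : SpatialDomain} {ψ χ : R3 → ℝ} (h : IsMultiplier D ψ)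
    (h' : IsMultiplier D χ) (he : ψ = χ) : h.toL2 = h'.toL2 := by
  subst he; rfl

/-! ### The curl-curl identity. -/

/-- For a test field `w`, both sides equal `-∫ v_j ∂_i ∂_j w_i`. Second derivatives fall only on
`w`, so `v ∈ V` needs no extra regularity, and density extends the identity to all `w`. -/
theorem inner_deriv_comm (D : SpatialDomain) (i j : Fin 3) (v w : V D) :
    ⟪deriv D i j v, deriv D j i w⟫_ℝ = ⟪deriv D j j v, deriv D i i w⟫_ℝ := by
  rw [← sub_eq_zero]
  refine eq_zero_of_testJets (innerSL ℝ (deriv D i j v) ∘L jetDeriv D j i -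
    innerSL ℝ (deriv D j j v) ∘L jetDeriv D i i) (fun z hz => ?_) w
  obtain ⟨φ, hφ, -, h2⟩ := testJets_spec hz
  change ⟪deriv D i j v, jetDeriv D j i z⟫_ℝ - ⟪deriv D j j v, jetDeriv D i i z⟫_ℝ = 0
  rw [h2, h2, real_inner_comm, inner_toL2_deriv, real_inner_comm _ (deriv D j j v),
    inner_toL2_deriv, sub_eq_zero, IsMultiplier.toL2_congr]
  ext x
  exact (hφ.isMultiplier i).fderiv_fderiv_comm _ _ _

theorem curl_apply (D : SpatialDomain) (v : V D) (i : Fin 3) :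
    curl D v i = (![deriv D 1 2 v - deriv D 2 1 v, deriv D 2 0 v - deriv D 0 2 v,
      deriv D 0 1 v - deriv D 1 0 v] : Fin 3 → Lp ℝ 2 D.measure) i := by
  fin_cases i <;> rfl

/-- On fields with the boundary conditions, `∇ × ∇ × v = -Δ v + ∇ (∇ • v)` in the weak sense. -/
theorem inner_curl_curl (D : SpatialDomain) (v w : V D) :
    ⟪curl D v, curl D w⟫_ℝ = energy D v w - ⟪div D v, div D w⟫_ℝ := by
  have h := inner_deriv_comm D
  have h01 := h 0 1 v w
  have h10 := h 1 0 v w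
  have h02 := h 0 2 v w
  have h20 := h 2 0 v w
  have h12 := h 1 2 v w
  have h21 := h 2 1 v w
  simp only [energy, div, PiLp.inner_apply, curl_apply, derivVec_apply, Fin.sum_univ_three,
    add_apply, inner_add_left, inner_add_right, Matrix.cons_val_zero,
    Matrix.cons_val_one, Matrix.cons_val, inner_sub_left, inner_sub_right]
  linarith

/-- Incompressibility removes the only term by which the curl form differs from the Dirichlet form.
-/
theorem weakCurl_curl_apply {D : SpatialDomain} {v : V D} (hv : div D v = 0) (w : V D) :
    weakCurl D (curl D v) w = energy D v w := by
  change ⟪curl D v, curl D w⟫_ℝ = _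
  rw [inner_curl_curl, hv, inner_zero_left, sub_zero]

/-! ### Fields in `V` with vanishing gradient. -/

theorem IsMultiplier.exists_bound_translate {D : SpatialDomain} {θ : R3 → ℝ}
    (hθ : IsMultiplier D θ) (r : ℝ) :
    ∃ C, ∀ x ∈ D.carrier, ∀ a : R3, ‖a‖ ≤ r → ‖θ (x + a)‖ ≤ C := by
  obtain ⟨R, _, hR⟩ := D.exists_norm_le
  obtain ⟨C, hC⟩ := (isCompact_closedBall (0 : R3) (R + r)).exists_bound_of_continuousOn
    hθ.continuous.continuousOn
  exact ⟨C, fun x hx a ha => hC _ (mem_closedBall_zero_iff.2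
    ((norm_add_le _ _).trans (add_le_add (hR x hx) ha)))⟩

theorem IsMultiplier.integrable_mul {D : SpatialDomain} {θ f : R3 → ℝ} (hθ : IsMultiplier D θ)
    (hf : Integrable f D.measure) : Integrable (fun x => θ x * f x) D.measure := by
  obtain ⟨C, hC⟩ := hθ.exists_bound_translate 0
  refine hf.bdd_mul (c := C) hθ.continuous.aestronglyMeasurable ?_
  filter_upwards [ae_mem_carrier D] with x hx
  simpa using hC x hx 0 (by simp)

/-- A function with vanishing weak gradient pairs with a multiplier in a translation invariant
way. -/
theorem integral_translate_mul {D : SpatialDomain} {f : R3 → ℝ} (hf : Integrable f D.measure)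
    (hgrad : ∀ ψ, IsMultiplier D ψ → ∀ j, ∫ x, fderiv ℝ ψ x (unitVec j) * f x ∂D.measure = 0)
    {θ : R3 → ℝ} (hθ : IsMultiplier D θ) (a : R3) :
    ∫ x, θ (x + a) * f x ∂D.measure = ∫ x, θ x * f x ∂D.measure := by
  have hdir : ∀ ψ, IsMultiplier D ψ → ∫ x, fderiv ℝ ψ x a * f x ∂D.measure = 0 := by
    intro ψ hψ
    have ha : a = ∑ j, a j • unitVec j := by
      ext k; fin_cases k <;> simp [Fin.sum_univ_three]
    have h1 : ∀ x, fderiv ℝ ψ x a * f x =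
        ∑ j, a j * (fderiv ℝ ψ x (unitVec j) * f x) := by
      intro x
      conv_lhs => rw [ha]
      rw [map_sum, Finset.sum_mul]
      exact Finset.sum_congr rfl fun j _ => by rw [map_smul, smul_eq_mul, mul_assoc]
    simp only [h1]
    rw [integral_finsetSum _ fun j _ =>
      ((hψ.fderiv_apply (unitVec j)).integrable_mul hf).const_mul _]
    exact Finset.sum_eq_zero fun j _ => by rw [integral_const_mul, hgrad ψ hψ j, mul_zero]
  -- Translates of `θ` are again multipliers, so differentiating under the integral leaves a
  -- directional derivative of a multiplier paired with `f`, which is zero.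
  have hderiv : ∀ t₀ : ℝ, HasDerivAt (fun t : ℝ => ∫ x, θ (x + t • a) * f x ∂D.measure) 0 t₀ := by
    intro t₀
    have hθ' := hθ.fderiv_apply a
    -- This radius covers `t • a` for every `t` at distance less than 1 from `t₀`.
    obtain ⟨C, hC⟩ := hθ'.exists_bound_translate ((|t₀| + 1) * ‖a‖)
    have h := (hasDerivAt_integral_of_dominated_loc_of_deriv_le (μ := D.measure)
      (F := fun t x => θ (x + t • a) * f x) (F' := fun t x => fderiv ℝ θ (x + t • a) a * f x)
      (x₀ := t₀) (bound := fun x => C * ‖f x‖) (Metric.ball_mem_nhds t₀ one_pos)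
      (Filter.Eventually.of_forall fun t =>
        ((hθ.translate (t • a)).integrable_mul hf).aestronglyMeasurable)
      ((hθ.translate (t₀ • a)).integrable_mul hf)
      ((hθ'.translate (t₀ • a)).integrable_mul hf).aestronglyMeasurable
      (by
        filter_upwards [ae_mem_carrier D] with x hx t ht
        rw [norm_mul]
        refine mul_le_mul_of_nonneg_right (hC x hx _ ?_) (norm_nonneg _)
        rw [norm_smul]
        refine mul_le_mul_of_nonneg_right ?_ (norm_nonneg _)
        have h1 : |t - t₀| < 1 := ht
        have h2 := abs_sub_abs_le_abs_sub t t₀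
        rw [Real.norm_eq_abs]; linarith)
      (hf.norm.const_mul C)
      (Filter.Eventually.of_forall fun x t _ => by
        have h1 : HasDerivAt (fun t : ℝ => x + t • a) a t := by
          simpa using ((hasDerivAt_id t).smul_const a).const_add x
        exact ((hθ.differentiable _).hasFDerivAt.comp_hasDerivAt t h1).mul_const _)).2
    have h0 : ∫ x, fderiv ℝ θ (x + t₀ • a) a * f x ∂D.measure = 0 := by
      rw [← hdir _ (hθ.translate (t₀ • a))]
      simp only [fderiv_comp_add_right]
    rwa [h0] at h
  have h := is_const_of_deriv_eq_zero (fun t => (hderiv t).differentiableAt)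
    (fun t => (hderiv t).deriv) 1 0
  simpa using h

/-- A function on a periodic box with vanishing weak gradient is orthogonal to the multipliers of
zero mean. -/
theorem integral_mul_eq_zero_of_periodic {L : Fin 3 → ℝ} {hL : ∀ i, 0 < L i} {f θ : R3 → ℝ}
    (hf : Integrable f (SpatialDomain.periodicBox L hL).measure)
    (hgrad : ∀ ψ, IsMultiplier (.periodicBox L hL) ψ → ∀ j,
      ∫ x, fderiv ℝ ψ x (unitVec j) * f x ∂(SpatialDomain.periodicBox L hL).measure = 0)
    (hθ : IsMultiplier (.periodicBox L hL) θ)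
    (hmean : ∫ x, θ x ∂(SpatialDomain.periodicBox L hL).measure = 0) :
    ∫ x, θ x * f x ∂(SpatialDomain.periodicBox L hL).measure = 0 := by
  set D := SpatialDomain.periodicBox L hL
  -- The constant 1 has zero weak gradient on the box, so the mean of `θ` is translation invariant
  -- too.
  have hshift : ∀ a, ∫ x, θ (x + a) ∂D.measure = 0 := by
    intro a
    have h := integral_translate_mul (D := D) (f := fun _ => 1) (integrable_const 1)
      (fun ψ hψ j => by simpa using integral_fderiv_periodic L hL hψ j) hθ a
    simpa [hmean] using h
  have hint : Integrable (fun z : R3 × R3 => θ (z.2 + z.1) * f z.2) (D.measure.prod D.measure) := by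
    obtain ⟨R, _, hR⟩ := D.exists_norm_le
    obtain ⟨C, hC⟩ := hθ.exists_bound_translate R
    refine (hf.comp_snd D.measure).bdd_mul (c := C)
      (hθ.continuous.comp (by fun_prop)).aestronglyMeasurable ?_
    have h1 : ∀ᵐ z ∂D.measure.prod D.measure, z.1 ∈ D.carrier :=
      Measure.quasiMeasurePreserving_fst.ae (ae_mem_carrier D)
    have h2 : ∀ᵐ z ∂D.measure.prod D.measure, z.2 ∈ D.carrier :=
      Measure.quasiMeasurePreserving_snd.ae (ae_mem_carrier D)
    filter_upwards [h1, h2] with z hz1 hz2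
    exact hC _ hz2 _ (hR _ hz1)
  -- Averaging over translations `a` in the cell: the inner integral does not depend on `a`, while
  -- in the other order the `a`-integral is the zero mean of a translate of `θ`.
  have h1 : ∫ a, ∫ x, θ (x + a) * f x ∂D.measure ∂D.measure =
      D.measure.real Set.univ * ∫ x, θ x * f x ∂D.measure := by
    simp only [integral_translate_mul hf hgrad hθ, integral_const, smul_eq_mul]
  have h2 : ∫ a, ∫ x, θ (x + a) * f x ∂D.measure ∂D.measure = 0 := by
    rw [integral_integral_swap hint]
    have hshift' : ∀ x, ∫ a, θ (x + a) ∂D.measure = 0 := fun x => by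
      simpa only [add_comm x] using hshift x
    simp only [integral_mul_const, hshift', zero_mul, integral_zero]
  have h3 : D.measure.real Set.univ ≠ 0 := by
    rw [SpatialDomain.measure, measureReal_restrict_apply_univ]
    refine (measureReal_ne_zero_iff ?_).2 ?_
    · obtain ⟨R, _, hR⟩ := D.exists_norm_le
      exact (isBounded_iff_forall_norm_le.2 ⟨R, hR⟩).measure_lt_top.ne
    · refine (D.isOpen_carrier.measure_pos volume
        ⟨WithLp.toLp 2 fun i => L i / 2, fun i => ?_⟩).ne'
      have := hL i
      constructor <;> simp only <;> linarith
  rw [h2] at h1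
  exact (mul_eq_zero.1 h1.symm).resolve_left h3

/-- A function with vanishing weak gradient is orthogonal to the components of test fields. -/
theorem IsTest.integral_mul_eq_zero {D : SpatialDomain} {f : R3 → ℝ}
    (hf : Integrable f D.measure)
    (hgrad : ∀ ψ, IsMultiplier D ψ → ∀ j, ∫ x, fderiv ℝ ψ x (unitVec j) * f x ∂D.measure = 0)
    {φ : R3 → R3} (hφ : IsTest D φ) (i : Fin 3) :
    ∫ x, φ x i * f x ∂D.measure = 0 := by
  cases D with
  | periodicBox L hL =>
    exact integral_mul_eq_zero_of_periodic hf hgrad (hφ.isMultiplier i) (hφ.2.2 i)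
  | noSlip Ω ho hb =>
    obtain ⟨R, hR0, hR⟩ := (SpatialDomain.noSlip Ω ho hb).exists_norm_le
    -- Any shift longer than `2 * R`, a bound for the diameter of `Ω`, moves the support of `φ` off
    -- `Ω`.
    rw [← integral_translate_mul hf hgrad (hφ.isMultiplier i) ((3 * R) • unitVec 0)]
    refine integral_eq_zero_of_ae ?_
    filter_upwards [ae_mem_carrier _] with x hx
    have h0 : φ (x + (3 * R) • unitVec 0) = 0 := by
      refine image_eq_zero_of_notMem_tsupport fun h => ?_
      have h1 := hR _ (hφ.2.2 h)
      have h2 := hR x hx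
      have h3 : ‖(3 * R) • unitVec 0‖ = 3 * R := by
        rw [norm_smul, PiLp.norm_single, Real.norm_of_nonneg (by positivity)]
        simp
      have h4 := norm_sub_le (x + (3 * R) • unitVec 0) x
      rw [add_sub_cancel_left, h3] at h4
      linarith
    simp [h0]

/-- A field in `V` with vanishing gradient vanishes. -/
theorem val_eq_zero_of_deriv_eq_zero {D : SpatialDomain} {e : V D}
    (he : ∀ j i, deriv D j i e = 0) : val D e = 0 := by
  have hzero : ∀ z ∈ testJets D, ∑ i, ⟪val D e i, jetVal D i z⟫_ℝ = 0 := by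
    intro z hz
    obtain ⟨φ, hφ, h1, -⟩ := testJets_spec hz
    refine Finset.sum_eq_zero fun i _ => ?_
    rw [h1, real_inner_comm, IsMultiplier.inner_toL2]
    refine hφ.integral_mul_eq_zero ((Lp.memLp (val D e i)).integrable (by simp))
      (fun ψ hψ j => ?_) i
    have h := inner_toL2_deriv hψ j i e
    rw [he, inner_zero_right, IsMultiplier.inner_toL2] at h
    linarith
  -- Orthogonality to the test fields passes to all of `V`, hence to `e` itself.
  have h := eq_zero_of_testJets (∑ i, innerSL ℝ (val D e i) ∘L jetVal D i)
    (fun z hz => by simpa [sum_apply] using hzero z hz) e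
  rw [← inner_self_eq_zero (𝕜 := ℝ), PiLp.inner_apply]
  simpa [sum_apply, jetVal_jet] using h

/-! ### Positivity of `A` and comparison of spectral components. -/

theorem energy_comm (D : SpatialDomain) (v w : V D) : energy D v w = energy D w v :=
  Finset.sum_congr rfl fun _ _ => real_inner_comm _ _

theorem deriv_eq_zero_of_energy_nonpos {D : SpatialDomain} {e : V D} (he : energy D e e ≤ 0)
    (j i : Fin 3) : deriv D j i e = 0 := by
  have h0 : energy D e e = 0 :=
    le_antisymm he (Finset.sum_nonneg fun _ _ => real_inner_self_nonneg)
  have h1 := (Finset.sum_eq_zero_iff_of_nonneg fun _ _ => real_inner_self_nonneg).1 h0 j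
    (Finset.mem_univ j)
  have h2 : derivVec D j e = 0 := inner_self_eq_zero.1 h1
  rw [← derivVec_apply, h2]; rfl

/-- `A = -Δ` is positive definite. -/
theorem val_eq_zero_of_mem_eigenspace {D : SpatialDomain} {lam : ℝ} (hlam : lam ≤ 0) {e : V D}
    (he : e ∈ eigenspace D lam) : val D e = 0 := by
  refine val_eq_zero_of_deriv_eq_zero (deriv_eq_zero_of_energy_nonpos ?_)
  rw [show energy D e e = lam * ⟪val D e, val D e⟫_ℝ from he e]
  exact mul_nonpos_of_nonpos_of_nonneg hlam real_inner_self_nonneg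

theorem val_component_weakCurl_curl {D : SpatialDomain} {v : V D} (hv : div D v = 0) (lam : ℝ) :
    val D (component D lam (weakCurl D (curl D v))) =
      lam • val D (component D lam (ofL2 D (val D v))) := by
  set a := component D lam (weakCurl D (curl D v)) with ha
  set b := component D lam (ofL2 D (val D v)) with hb
  -- The difference lies in the eigenspace and is `L²`-orthogonal to it, hence to itself.
  have hmem : a - lam • b ∈ eigenspace D lam :=
    sub_mem (component_mem _ _ _) (Submodule.smul_mem _ _ (component_mem _ _ _))
  have h : ∀ e ∈ eigenspace D lam, ⟪val D (a - lam • b), val D e⟫_ℝ = 0 := by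
    intro e he
    rw [map_sub, map_smul, inner_sub_left, real_inner_smul_left, ha, hb,
      inner_component D lam _ e he, inner_component D lam _ e he, weakCurl_curl_apply hv,
      energy_comm, show energy D e v = lam * ⟪val D e, val D v⟫_ℝ from he v, real_inner_comm]
    exact sub_self _
  rw [← sub_eq_zero, ← map_smul, ← map_sub]
  exact inner_self_eq_zero.1 (h _ hmem)

/-- The power law `lam ^ (s - 1) * lam = lam ^ s` is used only for `lam > 0`; for `lam ≤ 0`, where
real powers take conventional values, both components are zero. -/
theorem rpow_smul_component {D : SpatialDomain} {v : V D} (hv : div D v = 0) (s lam : ℝ) :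
    lam ^ (s - 1) • val D (component D lam (weakCurl D (curl D v))) =
      lam ^ s • val D (component D lam (ofL2 D (val D v))) := by
  rcases le_or_gt lam 0 with h | h
  · rw [val_eq_zero_of_mem_eigenspace h (component_mem _ _ _),
      val_eq_zero_of_mem_eigenspace h (component_mem _ _ _), smul_zero, smul_zero]
  · rw [val_component_weakCurl_curl hv, smul_smul, Real.rpow_sub_one h.ne', div_mul_cancel₀ _ h.ne']

end Fluid

end

theorem theorem1 (D : Fluid.SpatialDomain) (T : ℝ) (u : ℝ → Fluid.V D) (p : ℝ → Fluid.R3 → ℝ)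
    (hu : Fluid.IsNavierStokesSolution D T u p ∨ Fluid.IsEulerSolution D T u p)
    (t : ℝ) (ht : t ∈ Set.Ioo 0 T) (s : ℝ)
    (hs : Fluid.ofL2 D (Fluid.val D (u t)) ∈ (Fluid.powA D s).domain) :
    ∃ hω : Fluid.weakCurl D (Fluid.curl D (u t)) ∈ (Fluid.powA D (s - 1)).domain,
      Fluid.powA D s ⟨Fluid.ofL2 D (Fluid.val D (u t)), hs⟩ =
        Fluid.powA D (s - 1) ⟨Fluid.weakCurl D (Fluid.curl D (u t)), hω⟩ := by
  have hdiv : Fluid.div D (u t) = 0 := by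
    rcases hu with ⟨ν, _, g, h⟩ | h <;> exact h.div_eq_zero t ht
  -- Equality of the terms for every real `lam` transfers both the convergence of the series and its
  -- sum.
  have hterm := Fluid.rpow_smul_component hdiv s
  refine ⟨(summable_congr hterm).2 hs, ?_⟩
  exact (tsum_congr hterm).symm
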